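/- Let $B_n$ denote the lattice of all subsets of $[n]=\{1,\dots,n\}$ ordered by inclusion. Its $k$-th layer consists of the $k$-element sets. Let $M_{n,k}$ denote the middle $k$ layers of $B_n$, i.e. the sets of sizes $s,s+1,\dots,s+k-1$, where $s=\max(0,\lfloor (n+1-k)/2\rfloor)$. A family $\mathcal F\subseteq B_n$ contains a copy of a poset $P$ as a (weak) subposet if there is an order-preserving injection $P\to\mathcal F$, and contains an induced copy if there is an order embedding $P\to\mathcal F$. An $r$-daisy is a family $\{S\cup X: X\subseteq T,\ |X|=2\}$ with $|S|=r-2$, $|T|=4$, $S\cap T=\emptyset$. Densities of families in $B_n$ are measured relative to $w_n=\binom{n}{\lfloor n/2\rfloor}$. Let $c=\prod_{k=1}^\infty(1-2^{-k})\approx 0.29$; in particular $c>0$. Let $d\ge 4$. Then the following hold. 1. For every $n$, $M_{n,d}$ contains no copy of $B_d$, and every union of layers of $B_n$ that contains no induced copy of $B_d$ (in particular, every one that contains no copy of $B_d$) has size at most $|M_{n,d}|$. Moreover $|M_{n,d}|/w_n\to d$ as $n\to\infty$. 2. For every $n$ and every family $\mathcal G$ of $\lfloor n/2\rfloor$-element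 subsets of $[n]$ that contains no $\lfloor n/2\rfloor$-daisy, let $\mathcal F(\mathcal G)$ be obtained from $M_{n,d+1}$ by replacing the layer of $\lfloor n/2\rfloor$-element sets by $\mathcal G$. Then $\mathcal F(\mathcal G)$ contains no copy of $B_d$. 3. For every $n$ there is such a family $\mathcal G_n$ with $|\mathcal G_n|\ge c\,w_n$, and these can be chosen such that $|\mathcal F(\mathcal G_n)|\ge |M_{n,d}|+(c-o(1))\,w_n$ as $n\to\infty$. 4. Consequently the asymptotically greatest density of a subset of $B_n$ containing no copy of $B_d$ is not attained by unions of layers: if $\mathrm{La}(n)$ is the largest size of a subset of $B_n$ containing no copy of $B_d$, then there is no sequence of families $\mathcal U_n\subseteq B_n$, each a union of layers and, for all large $n$, containing no copy of $B_d$, such that $(\mathrm{La}(n)-|\mathcal U_n|)/w_n\to 0$. The same holds with "induced copy" in place of "copy" throughout. -/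

import Mathlib

open Filter Topology

/-! The `n`-dimensional Boolean lattice is `Finset (Fin n)`, ordered by inclusion.
A family in it is an element of `Finset (Finset (Fin n))`. -/

/-- The family of all subsets of `[n]` whose size lies in `I`: a union of layers. -/
def layersUnion (n : ℕ) (I : Finset ℕ) : Finset (Finset (Fin n)) :=
  Finset.univ.filter (fun A => A.card ∈ I)

/-- The `k`-th layer of the Boolean lattice. -/
def layer (n k : ℕ) : Finset (Finset (Fin n)) :=
  layersUnion n {k}

/-- The middle `k` layers: sizes `s, s + 1, …, s + k - 1` with `s = ⌊(n + 1 - k) / 2⌋`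
(of the two most central choices, the lower one, if `n + 1 - k` is odd). -/
def middleLayers (n k : ℕ) : Finset (Finset (Fin n)) :=
  layersUnion n (Finset.Ico ((n + 1 - k) / 2) ((n + 1 - k) / 2 + k))

/-- The middle `d + 1` layers, with the layer of the sets of size `⌊n / 2⌋` (always a middle one
among these) replaced by `G`. -/
def replaceMiddle (n d : ℕ) (G : Finset (Finset (Fin n))) : Finset (Finset (Fin n)) :=
  (middleLayers n (d + 1) \ layer n (n / 2)) ∪ G

/-- The daisy with stem `S` on the further vertices `T`: all `S ∪ X`, `X` a 2-subset of `T`. -/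
def daisy {n : ℕ} (S T : Finset (Fin n)) : Finset (Finset (Fin n)) :=
  (T.powersetCard 2).image (fun X => S ∪ X)

/-- `G` contains no `r`-daisy. -/
def DaisyFree {n : ℕ} (r : ℕ) (G : Finset (Finset (Fin n))) : Prop :=
  ∀ S T : Finset (Fin n), S.card + 2 = r → T.card = 4 → Disjoint S T → ¬ daisy S T ⊆ G

/-- `F` contains a copy of `P` as a (weak) subposet: an order-preserving injection `P → F`. -/
def ContainsCopy (P : Type*) [PartialOrder P] {n : ℕ} (F : Finset (Finset (Fin n))) : Prop :=
  ∃ f : P → Finset (Fin n), Function.Injective f ∧ Monotone f ∧ ∀ p, f p ∈ F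

/-- `F` contains a copy of `P` as an induced subposet: an order embedding `P → F`. -/
def ContainsInducedCopy (P : Type*) [PartialOrder P] {n : ℕ} (F : Finset (Finset (Fin n))) :
    Prop :=
  ∃ f : P ↪o Finset (Fin n), ∀ p, f p ∈ F

/-- The size of the largest layer of the `n`-dimensional Boolean lattice, as a real number;
densities are measured relative to it. -/
def width (n : ℕ) : ℝ := (n.choose (n / 2) : ℝ)

open Classical in
/-- The largest size of a family of subsets of `[n]` with the property `Free`. -/
noncomputable def maxSize (n : ℕ) (Free : Finset (Finset (Fin n)) → Prop) : ℕ :=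
  (Finset.univ.filter Free).sup Finset.card

/-- The asymptotically greatest density of a family with the property `Free` is attained by
some union of layers (one for each large `n`). -/
def AttainedByLayers (Free : ∀ n : ℕ, Finset (Finset (Fin n)) → Prop) : Prop :=
  ∃ I : ℕ → Finset ℕ, (∀ᶠ n in atTop, Free n (layersUnion n (I n))) ∧
    Tendsto (fun n => ((maxSize n (Free n) : ℝ) - ((layersUnion n (I n)).card : ℝ)) / width n)
      atTop (𝓝 0)

/-- The constant `∏_{k ≥ 1} (1 - 2^{-k}) ≈ 0.29`. -/
noncomputable def daisyConst : ℝ := ∏' k : ℕ, (1 - (1 / 2 : ℝ) ^ (k + 1))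

/-- The infinite product defining `daisyConst` converges. -/
theorem multipliable_daisyConst : Multipliable (fun k : ℕ => 1 - (1 / 2 : ℝ) ^ (k + 1)) := by
  have h : Summable (fun k : ℕ => -(1 / 2 : ℝ) ^ (k + 1)) :=
    ((summable_nat_add_iff 1).2 summable_geometric_two).neg
  simpa [sub_eq_add_neg] using Real.multipliable_one_add_of_summable h

/-! A copy of `B_d` contains chains of `d + 1` sets, so `d` layers hold none, while any `d + 1`
layers hold an induced one; among unions of layers the middle `d` are thus optimal.

In `d + 1` consecutive layers a copy of `B_d` has no slack: rank forces every cardinality, so the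
copy is an interval (`exists_eq_union_image`). For `d ≥ 4` this interval meets the layer `n / 2` in
a family containing a daisy, so a daisy-free replacement of that layer destroys every copy
(`not_containsCopy_replaceMiddle`).

Dense daisy-free families come from linear algebra: attach to each point a vector of `𝔽₂ʳ` and keep
the `r`-sets that give bases. Modulo the span of the stem, a daisy would need four distinct nonzero
vectors in a plane over `𝔽₂`, which has three (`daisyFree_basisFamily`). For random vectors an
`r`-set gives a basis with probability at least `daisyConst`, so some choice does at least as well
as the average. As each middle layer has density tending to `1`, this beats `d` layers by a positive
density. -/

theorem card_layersUnion (n : ℕ) (I : Finset ℕ) :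
    (layersUnion n I).card = ∑ i ∈ I, n.choose i := by
  classical
  rw [Finset.card_eq_sum_card_fiberwise (f := Finset.card) (t := I)]
  · refine Finset.sum_congr rfl fun i hi => ?_
    have : (layersUnion n I).filter (fun A => A.card = i) =
        (Finset.univ : Finset (Fin n)).powersetCard i := by
      ext A
      simp only [layersUnion, Finset.mem_filter, Finset.mem_univ, true_and,
        Finset.mem_powersetCard, Finset.subset_univ]
      exact ⟨fun h => h.2, fun h => ⟨h ▸ hi, h⟩⟩
    rw [this, Finset.card_powersetCard, Finset.card_univ, Fintype.card_fin]
  · intro A hA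
    simpa [layersUnion] using hA

theorem mem_layersUnion {n : ℕ} {I : Finset ℕ} {A : Finset (Fin n)} :
    A ∈ layersUnion n I ↔ A.card ∈ I := by simp [layersUnion]

theorem mem_layer {n k : ℕ} {A : Finset (Fin n)} : A ∈ layer n k ↔ A.card = k := by
  simp [layer, mem_layersUnion]

theorem card_layer (n k : ℕ) : (layer n k).card = n.choose k := by
  simp [layer, card_layersUnion]

/-! ### Copies of `B_d` in unions of layers -/

/-- In an injective monotone image of a Boolean lattice, cardinalities grow at least as fast
as the rank. -/
theorem card_add_card_le_of_injective_monotone {d n : ℕ} {f : Finset (Fin d) → Finset (Fin n)}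
    (hinj : Function.Injective f) (hmono : Monotone f) (A C : Finset (Fin d))
    (h : Disjoint A C) : (f A).card + C.card ≤ (f (A ∪ C)).card := by
  classical
  induction C using Finset.induction_on with
  | empty => simp
  | insert a C ha ih =>
    rw [Finset.disjoint_insert_right] at h
    have h1 := ih h.2
    have h2 : f (A ∪ C) ⊂ f (A ∪ insert a C) := by
      refine (hmono.strictMono_of_injective hinj) ?_
      rw [Finset.union_insert]
      exact Finset.ssubset_insert (by simp [h.1, ha])
    have h3 := Finset.card_lt_card h2
    rw [Finset.card_insert_of_notMem ha]
    omega

theorem not_containsCopy_middleLayers (n d : ℕ) :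
    ¬ ContainsCopy (Finset (Fin d)) (middleLayers n d) := by
  rintro ⟨f, hinj, hmono, hf⟩
  have h := card_add_card_le_of_injective_monotone hinj hmono ∅ Finset.univ
    (Finset.disjoint_empty_left _)
  have h0 := hf ∅
  have h1 := hf Finset.univ
  simp only [middleLayers, mem_layersUnion, Finset.mem_Ico] at h0 h1
  simp only [Finset.empty_union, Finset.card_univ, Fintype.card_fin] at h
  omega

theorem ContainsInducedCopy.containsCopy {P : Type*} [PartialOrder P] {n : ℕ}
    {F : Finset (Finset (Fin n))} (h : ContainsInducedCopy P F) : ContainsCopy P F :=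
  let ⟨f, hf⟩ := h
  ⟨f, f.injective, f.monotone, hf⟩

/-- Any `d + 1` layers contain an induced copy of the `d`-dimensional Boolean lattice. -/
theorem containsInducedCopy_layersUnion {n d : ℕ} {I : Finset ℕ}
    (h : d < (I.filter (· ≤ n)).card) :
    ContainsInducedCopy (Finset (Fin d)) (layersUnion n I) := by
  classical
  obtain ⟨J, hJ, hJc⟩ := Finset.exists_subset_card_eq (Nat.succ_le_of_lt h)
  set e := J.orderEmbOfFin hJc
  have he : ∀ j, e j ∈ I ∧ e j ≤ n := fun j => by
    simpa using hJ (J.orderEmbOfFin_mem hJc j)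
  -- The chosen sizes increase strictly, so their excess over the rank is monotone; its two ends
  -- give the bounds `hj` and `hd`.
  have hm : Monotone (fun j : Fin (d + 1) => (e j : ℤ) - (j : ℕ)) := by
    refine Fin.monotone_iff_le_succ.2 fun i => ?_
    have : e i.castSucc < e i.succ := e.strictMono Fin.castSucc_lt_succ
    simp only [Fin.val_castSucc, Fin.val_succ]
    omega
  have hj : ∀ j : Fin (d + 1), (j : ℕ) ≤ e j := fun j => by
    have := hm (Fin.zero_le j)
    simp only [Fin.val_zero] at this
    omega
  have hd : ∀ j : Fin (d + 1), e j + d ≤ n + j := fun j => by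
    have := hm (Fin.le_last j)
    have := (he (Fin.last d)).2
    simp only [Fin.val_last] at *
    omega
  have hdn : d ≤ n := by
    have := hj (Fin.last d)
    have := (he (Fin.last d)).2
    simp only [Fin.val_last] at *
    omega
  have hlt : ∀ X : Finset (Fin d), X.card < d + 1 := fun X => by
    have := X.card_le_univ
    rw [Fintype.card_fin] at this
    omega
  -- The amount of padding: `X` sits on the first `d` points, and an initial segment of the other
  -- points lifts it to the prescribed size. Nested padding keeps the order, and the first `d`
  -- points reflect it.
  let c : Finset (Fin d) → ℕ := fun X => e ⟨X.card, hlt X⟩ - X.card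
  have hc : ∀ X Y, X ⊆ Y → c X ≤ c Y := fun X Y hXY => by
    have h1 : (⟨X.card, hlt X⟩ : Fin (d + 1)) ≤ ⟨Y.card, hlt Y⟩ := Finset.card_le_card hXY
    have := hm h1
    simp only at this
    simp only [c]
    omega
  let f : Finset (Fin d) → Finset (Fin n) := fun X =>
    X.map (Fin.castLEEmb hdn) ∪
      Finset.univ.filter (fun x : Fin n => d ≤ (x : ℕ) ∧ (x : ℕ) < d + c X)
  have hmem : ∀ X (a : Fin d), Fin.castLE hdn a ∈ f X ↔ a ∈ X := fun X a => by
    have : ¬ d ≤ (a : ℕ) := by omega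
    simp only [f, Finset.mem_union, Finset.mem_map, Fin.castLEEmb_apply, Finset.mem_filter,
      Finset.mem_univ, true_and, Fin.val_castLE, this, false_and, or_false]
    exact ⟨fun ⟨b, hb, hab⟩ => (Fin.castLE_injective hdn hab) ▸ hb, fun ha => ⟨a, ha, rfl⟩⟩
  refine ⟨OrderEmbedding.ofMapLEIff f fun X Y => ⟨fun hXY a ha => ?_, fun hXY => ?_⟩, fun X => ?_⟩
  · exact (hmem Y a).1 (hXY ((hmem X a).2 ha))
  · refine Finset.union_subset_union (Finset.map_subset_map.2 hXY) fun x hx => ?_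
    have := hc X Y hXY
    simp only [Finset.mem_filter, Finset.mem_univ, true_and] at hx ⊢
    omega
  · rw [mem_layersUnion]
    have hcX : c X + d ≤ n := by
      have := hd ⟨X.card, hlt X⟩
      have := hj ⟨X.card, hlt X⟩
      simp only [c] at *
      omega
    have h2 : (Finset.univ.filter
        (fun x : Fin n => d ≤ (x : ℕ) ∧ (x : ℕ) < d + c X)).card = c X := by
      have : (Finset.univ.filter (fun x : Fin n => d ≤ (x : ℕ) ∧ (x : ℕ) < d + c X)).map
          Fin.valEmbedding = Finset.Ico d (d + c X) := by
        ext y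
        simp only [Finset.mem_map, Finset.mem_filter, Finset.mem_univ, true_and,
          Fin.valEmbedding_apply, Finset.mem_Ico]
        exact ⟨fun ⟨x, hx, hxy⟩ => hxy ▸ hx, fun hy => ⟨⟨y, by omega⟩, hy, rfl⟩⟩
      rw [← Finset.card_map Fin.valEmbedding, this, Nat.card_Ico]
      omega
    have hfX : (f X).card = e ⟨X.card, hlt X⟩ := by
      simp only [f]
      rw [Finset.card_union_of_disjoint, Finset.card_map, h2]
      · have := hj ⟨X.card, hlt X⟩
        simp only [c] at *
        omega
      · rw [Finset.disjoint_left]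
        intro x hx hx'
        simp only [Finset.mem_map, Finset.mem_filter, Finset.mem_univ, true_and] at hx hx'
        obtain ⟨a, -, rfl⟩ := hx
        have := hx'.1
        simp only [Fin.castLEEmb_apply, Fin.val_castLE] at this
        omega
    change (f X).card ∈ I
    rw [hfX]
    exact (he _).1

/-! ### Optimality of the middle layers -/

theorem choose_le_choose_of_le_half {n a b : ℕ} (hab : a ≤ b) (hb : b ≤ n / 2) :
    n.choose a ≤ n.choose b := by
  induction b, hab using Nat.le_induction with
  | base => exact le_rfl
  | succ b _ ih =>
    exact (ih (by omega)).trans (Nat.choose_le_succ_of_lt_half_left (by omega))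

/-- A binomial coefficient is at least any one further from the middle. -/
theorem choose_le_choose_of_min_le {n k l : ℕ} (hl : l ≤ n)
    (h : min k (n - k) ≤ min l (n - l)) : n.choose k ≤ n.choose l := by
  rcases lt_or_ge n k with hk | hk
  · simp [Nat.choose_eq_zero_of_lt hk]
  have key : ∀ m ≤ n, n.choose m = n.choose (min m (n - m)) := fun m hm => by
    rcases le_total m (n - m) with h | h
    · rw [min_eq_left h]
    · rw [min_eq_right h, Nat.choose_symm hm]
  rw [key k hk, key l hl]
  exact choose_le_choose_of_le_half h (by omega)

/-- An exchange argument: the lowest middle layer `s` is also the smallest one, and no layer outside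
the middle exceeds it, so `n.choose s` separates the layers given up from those gained. -/
theorem card_layersUnion_le_card_middleLayers {n d : ℕ} (hd : 0 < d) {I : Finset ℕ}
    (h : (I.filter (· ≤ n)).card ≤ d) :
    (layersUnion n I).card ≤ (middleLayers n d).card := by
  classical
  rw [middleLayers, card_layersUnion, card_layersUnion]
  set s := (n + 1 - d) / 2 with hs
  set J := I.filter (· ≤ n)
  set M := Finset.Ico s (s + d)
  have hJ : ∑ i ∈ I, n.choose i = ∑ i ∈ J, n.choose i := by
    refine (Finset.sum_subset (Finset.filter_subset _ _) fun i hi hi' => ?_).symm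
    refine Nat.choose_eq_zero_of_lt ?_
    by_contra h
    exact hi' (Finset.mem_filter.2 ⟨hi, not_lt.1 h⟩)
  rw [hJ]
  -- If `n < d`, truncated subtraction gives `s = 0` and `M` contains every size up to `n`.
  rcases Nat.lt_or_ge n d with hn | hn
  · refine Finset.sum_le_sum_of_subset fun i hi => ?_
    simp only [J, M, Finset.mem_filter, Finset.mem_Ico] at hi ⊢
    omega
  have hMc : M.card = d := by simp [M]
  have hle : (J \ M).card ≤ (M \ J).card := by
    have h1 := Finset.card_sdiff_add_card_inter J M
    have h2 := Finset.card_sdiff_add_card_inter M J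
    rw [Finset.inter_comm] at h2
    omega
  rw [← Finset.sum_inter_add_sum_sdiff J M, ← Finset.sum_inter_add_sum_sdiff M J,
    Finset.inter_comm M J]
  refine Nat.add_le_add_left ?_ _
  calc ∑ i ∈ J \ M, n.choose i ≤ (J \ M).card • n.choose s := by
        refine Finset.sum_le_card_nsmul _ _ _ fun i hi => ?_
        simp only [J, M, Finset.mem_sdiff, Finset.mem_filter, Finset.mem_Ico] at hi
        exact choose_le_choose_of_min_le (by omega) (by omega)
    _ ≤ (M \ J).card • n.choose s := Nat.mul_le_mul_right _ hle
    _ ≤ ∑ i ∈ M \ J, n.choose i := by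
        refine Finset.card_nsmul_le_sum _ _ _ fun i hi => ?_
        simp only [M, Finset.mem_sdiff, Finset.mem_Ico] at hi
        exact choose_le_choose_of_min_le (by omega) (by omega)

/-! ### Asymptotic density of layers near the middle -/

theorem width_pos (n : ℕ) : 0 < width n :=
  Nat.cast_pos.2 (Nat.choose_pos (Nat.div_le_self n 2))

/-- Consecutive binomial coefficients at `k = n / 2 + j` have ratio `(n - k) / (k + 1)`, which tends
to `1` for fixed `j`. -/
theorem tendsto_choose_half_add_div_width (j : ℕ) :
    Tendsto (fun n : ℕ => (n.choose (n / 2 + j) : ℝ) / width n) atTop (𝓝 1) := by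
  induction j with
  | zero =>
    refine tendsto_const_nhds.congr fun n => ?_
    rw [add_zero]
    exact (div_self (width_pos n).ne').symm
  | succ j ih =>
    have hden : Tendsto (fun n : ℕ => ((n / 2 + j + 1 : ℕ) : ℝ)) atTop atTop := by
      refine tendsto_natCast_atTop_atTop.comp (tendsto_atTop.2 fun b => ?_)
      filter_upwards [eventually_ge_atTop (2 * b)] with n hn
      omega
    have hz : Tendsto (fun n : ℕ => (2 * j + 1 : ℝ) / ((n / 2 + j + 1 : ℕ) : ℝ)) atTop (𝓝 0) :=
      hden.const_div_atTop _
    have hr : Tendsto (fun n : ℕ => ((n : ℝ) - (n / 2 + j : ℕ)) / ((n / 2 + j + 1 : ℕ) : ℝ))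
        atTop (𝓝 1) := by
      have hlow : Tendsto (fun n : ℕ => 1 - (2 * j + 1 : ℝ) / ((n / 2 + j + 1 : ℕ) : ℝ))
          atTop (𝓝 1) := by simpa using hz.const_sub 1
      refine tendsto_of_tendsto_of_tendsto_of_le_of_le hlow tendsto_const_nhds
        (fun n => ?_) (fun n => ?_)
      · have hp : (0 : ℝ) < ((n / 2 + j + 1 : ℕ) : ℝ) := by positivity
        have h2 : ((2 * (n / 2) : ℕ) : ℝ) ≤ n := by exact_mod_cast Nat.mul_div_le n 2
        change 1 - _ ≤ _
        rw [sub_le_iff_le_add, ← add_div, le_div_iff₀ hp]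
        push_cast at *
        linarith
      · have hp : (0 : ℝ) < ((n / 2 + j + 1 : ℕ) : ℝ) := by positivity
        have h2 : (n : ℝ) ≤ ((2 * (n / 2) + 1 : ℕ) : ℝ) := by
          exact_mod_cast (by omega : n ≤ 2 * (n / 2) + 1)
        change _ ≤ (1 : ℝ)
        rw [div_le_one hp]
        push_cast at *
        linarith
    have := ih.mul hr
    rw [mul_one] at this
    refine this.congr' ?_
    filter_upwards [eventually_ge_atTop (2 * j)] with n hn
    have h := Nat.choose_succ_right_eq n (n / 2 + j)
    have h' : (n.choose (n / 2 + j + 1) : ℝ) * ((n / 2 + j + 1 : ℕ) : ℝ) =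
        n.choose (n / 2 + j) * ((n : ℝ) - (n / 2 + j : ℕ)) := by
      rw [← Nat.cast_sub (by omega : n / 2 + j ≤ n)]
      exact_mod_cast h
    have hp : ((n / 2 + j + 1 : ℕ) : ℝ) ≠ 0 := by positivity
    have hw := (width_pos n).ne'
    rw [div_mul_div_comm, ← h', mul_div_mul_right _ _ hp]
    rfl

theorem tendsto_choose_div_width {k : ℕ → ℕ} (j : ℕ)
    (hk : ∀ᶠ n in atTop, n / 2 ≤ k n + j ∧ k n ≤ n / 2 + j) :
    Tendsto (fun n : ℕ => (n.choose (k n) : ℝ) / width n) atTop (𝓝 1) := by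
  refine tendsto_of_tendsto_of_tendsto_of_le_of_le'
    -- The shift `j + 1` instead of `j` is for odd `n`, where `n / 2 - j` is further from the middle
    -- than `n / 2 + j`.
    (tendsto_choose_half_add_div_width (j + 1)) tendsto_const_nhds ?_ ?_
  · filter_upwards [hk, eventually_ge_atTop (2 * j + 2)] with n hn hn'
    refine div_le_div_of_nonneg_right ?_ (width_pos n).le
    exact_mod_cast choose_le_choose_of_min_le (by omega) (by omega)
  · refine Eventually.of_forall fun n => (div_le_one (width_pos n)).2 ?_
    exact Nat.cast_le.2 (Nat.choose_le_middle _ _)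

theorem tendsto_card_middleLayers_div_width (d : ℕ) :
    Tendsto (fun n : ℕ => ((middleLayers n d).card : ℝ) / width n) atTop (𝓝 (d : ℝ)) := by
  have h : Tendsto (fun n : ℕ => ∑ i ∈ Finset.range d,
      (n.choose ((n + 1 - d) / 2 + i) : ℝ) / width n) atTop
      (𝓝 (∑ _i ∈ Finset.range d, (1 : ℝ))) := by
    refine tendsto_finsetSum _ fun i hi => tendsto_choose_div_width d ?_
    rw [Finset.mem_range] at hi
    exact Eventually.of_forall fun n => by omega
  simp only [Finset.sum_const, Finset.card_range, nsmul_eq_mul, mul_one] at h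
  refine h.congr fun n => ?_
  rw [middleLayers, card_layersUnion, Finset.sum_Ico_eq_sum_range, ← Finset.sum_div]
  simp

/-! ### Replacing a middle layer by a daisy-free family -/

theorem mem_replaceMiddle {n d : ℕ} {G : Finset (Finset (Fin n))} {A : Finset (Fin n)} :
    A ∈ replaceMiddle n d G ↔
      (A ∈ middleLayers n (d + 1) ∧ A.card ≠ n / 2) ∨ A ∈ G := by
  simp [replaceMiddle, mem_layer]

/-- An injective monotone image of a Boolean lattice in which cardinalities grow exactly
as the rank is an interval. -/
theorem exists_eq_union_image {d n : ℕ} {f : Finset (Fin d) → Finset (Fin n)}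
    (hinj : Function.Injective f) (hmono : Monotone f)
    (hc : ∀ X, (f X).card = (f ∅).card + X.card) :
    ∃ x : Fin d → Fin n, Function.Injective x ∧ (∀ i, x i ∉ f ∅) ∧
      ∀ X, f X = f ∅ ∪ X.image x := by
  classical
  have hx : ∀ i, ∃ a, f {i} \ f ∅ = {a} := fun i => by
    rw [← Finset.card_eq_one, Finset.card_sdiff_of_subset (hmono (Finset.empty_subset _)), hc {i}]
    simp
  choose x hx using hx
  have hmem : ∀ i, x i ∈ f {i} \ f ∅ := fun i => by rw [hx]; exact Finset.mem_singleton_self _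
  have hfi : ∀ i, f {i} = f ∅ ∪ {x i} := fun i => by
    rw [← hx, Finset.union_sdiff_of_subset (hmono (Finset.empty_subset _))]
  have hxinj : Function.Injective x := fun i j hij => by
    have : f {i} = f {j} := by rw [hfi, hfi, hij]
    exact Finset.singleton_injective (hinj this)
  have hn : ∀ i, x i ∉ f ∅ := fun i => (Finset.mem_sdiff.1 (hmem i)).2
  refine ⟨x, hxinj, hn, fun X => (Finset.eq_of_subset_of_card_le ?_ ?_).symm⟩
  · refine Finset.union_subset (hmono (Finset.empty_subset _)) ?_
    rw [Finset.image_subset_iff]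
    exact fun i hi => hmono (Finset.singleton_subset_iff.2 hi) (Finset.mem_sdiff.1 (hmem i)).1
  · rw [hc, Finset.card_union_of_disjoint, Finset.card_image_of_injective _ hxinj]
    rw [Finset.disjoint_right]
    intro a ha
    obtain ⟨i, -, rfl⟩ := Finset.mem_image.1 ha
    exact hn i

theorem not_containsCopy_replaceMiddle {d : ℕ} (hd : 4 ≤ d) {n : ℕ}
    {G : Finset (Finset (Fin n))} (hG : G ⊆ layer n (n / 2)) (hfree : DaisyFree (n / 2) G) :
    ¬ ContainsCopy (Finset (Fin d)) (replaceMiddle n d G) := by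
  classical
  rintro ⟨f, hinj, hmono, hf⟩
  have hgrow := card_add_card_le_of_injective_monotone hinj hmono
  have hsize : ∀ X, (f X).card ∈ Finset.Ico ((n - d) / 2) ((n - d) / 2 + d + 1) := fun X => by
    rcases mem_replaceMiddle.1 (hf X) with h | h
    · have := h.1
      rw [middleLayers, mem_layersUnion] at this
      simpa [Nat.add_sub_add_right, add_assoc] using this
    · have := mem_layer.1 (hG h)
      rw [this, Finset.mem_Ico]
      omega
  simp only [Finset.mem_Ico] at hsize
  -- Growth from `∅` to `X` and from `X` to the top already uses up all `d + 1` sizes, so both are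
  -- exact.
  have hc : ∀ X, (f X).card = (n - d) / 2 + X.card := fun X => by
    have h1 := hgrow ∅ X (Finset.disjoint_empty_left _)
    have h2 := hgrow X Xᶜ disjoint_compl_right
    have h3 := Finset.card_add_card_compl X
    rw [Finset.empty_union] at h1
    rw [Finset.union_compl] at h2
    rw [Fintype.card_fin] at h3
    have := hsize ∅
    have := hsize Finset.univ
    omega
  have hdn : d ≤ n := by
    have h1 := hc Finset.univ
    have h2 := (f Finset.univ).card_le_univ
    rw [Finset.card_univ, Fintype.card_fin] at h1
    rw [Fintype.card_fin] at h2
    omega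
  have hc0 : (f ∅).card = (n - d) / 2 := by simpa using hc ∅
  obtain ⟨x, hxinj, hxn, hfx⟩ := exists_eq_union_image hinj hmono (fun X => by rw [hc, hc0])
  -- The layer `n / 2` has rank `j + 2` in the copy. Here `d ≥ 4` gives both a rank of at least `2`
  -- and `j + 4 ≤ d`, leaving room for a stem `U` of size `j` and four further points `V`.
  obtain ⟨j, hj⟩ : ∃ j, n / 2 = (n - d) / 2 + 2 + j := ⟨n / 2 - (n - d) / 2 - 2, by omega⟩
  obtain ⟨U, hU⟩ := Finset.exists_subset_card_eq (s := (Finset.univ : Finset (Fin d))) (n := j)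
    (by rw [Finset.card_univ, Fintype.card_fin]; omega)
  obtain ⟨V, hVU, hV⟩ := Finset.exists_subset_card_eq (s := Uᶜ) (n := 4)
    (by rw [Finset.card_compl, Fintype.card_fin]; omega)
  have hdisj : Disjoint U V :=
    Finset.disjoint_left.2 fun a ha hb => Finset.mem_compl.1 (hVU hb) ha
  refine hfree (f U) (V.image x) ?_ ?_ ?_ ?_
  · rw [hc, hU.2]
    omega
  · rw [Finset.card_image_of_injective _ hxinj, hV]
  · rw [hfx, Finset.disjoint_union_left, Finset.disjoint_image hxinj]
    refine ⟨Finset.disjoint_right.2 fun a ha => ?_, hdisj⟩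
    obtain ⟨i, -, rfl⟩ := Finset.mem_image.1 ha
    exact hxn i
  · intro A hA
    obtain ⟨Y, hY, rfl⟩ := Finset.mem_image.1 hA
    obtain ⟨hY, hY2⟩ := Finset.mem_powersetCard.1 hY
    obtain ⟨X, hXV, rfl⟩ := Finset.subset_image_iff.1 hY
    rw [Finset.card_image_of_injective _ hxinj] at hY2
    have hUX : f U ∪ X.image x = f (U ∪ X) := by
      rw [hfx U, hfx (U ∪ X), Finset.image_union, Finset.union_assoc]
    rw [hUX]
    refine (mem_replaceMiddle.1 (hf (U ∪ X))).resolve_left fun h => h.2 ?_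
    rw [hc, Finset.card_union_of_disjoint (hdisj.mono_right hXV), hU.2, hY2]
    omega

/-! ### The constant `daisyConst` -/

theorem antitone_prod_one_sub_half_pow :
    Antitone (fun n : ℕ => ∏ k ∈ Finset.range n, (1 - (1 / 2 : ℝ) ^ (k + 1))) := by
  refine antitone_nat_of_succ_le fun n => ?_
  rw [Finset.prod_range_succ]
  refine mul_le_of_le_one_right (Finset.prod_nonneg fun k _ => ?_) ?_
  · exact sub_nonneg.2 (pow_le_one₀ (by norm_num) (by norm_num))
  · exact sub_le_self _ (by positivity)

theorem tendsto_prod_daisyConst :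
    Tendsto (fun n : ℕ => ∏ k ∈ Finset.range n, (1 - (1 / 2 : ℝ) ^ (k + 1))) atTop
      (𝓝 daisyConst) :=
  multipliable_daisyConst.hasProd.tendsto_prod_nat

theorem daisyConst_le_prod (r : ℕ) :
    daisyConst ≤ ∏ k ∈ Finset.range r, (1 - (1 / 2 : ℝ) ^ (k + 1)) :=
  antitone_prod_one_sub_half_pow.le_of_tendsto tendsto_prod_daisyConst r

theorem daisyConst_pos : 0 < daisyConst := by
  -- The extra term makes the induction close: with `x = (1 / 2) ^ (n + 2) ≤ 1 / 4`, one has `(1 / 4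
  -- + x) * (1 - x) ≥ 1 / 4 + x / 2`.
  have h : ∀ n : ℕ, (1 / 4 : ℝ) + (1 / 2) ^ (n + 2) ≤
      ∏ k ∈ Finset.range (n + 1), (1 - (1 / 2 : ℝ) ^ (k + 1)) := fun n => by
    induction n with
    | zero => norm_num
    | succ n ih =>
      rw [Finset.prod_range_succ]
      have h0 : (0 : ℝ) < (1 / 2) ^ n := by positivity
      have h1 : (1 / 2 : ℝ) ^ n ≤ 1 := pow_le_one₀ (by norm_num) (by norm_num)
      refine le_trans ?_ (mul_le_mul_of_nonneg_right ih ?_)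
      · simp only [pow_succ]
        nlinarith
      · exact sub_nonneg.2 (pow_le_one₀ (by norm_num) (by norm_num))
  have : (1 / 4 : ℝ) ≤ daisyConst :=
    ge_of_tendsto' ((tendsto_add_atTop_iff_nat 1).2 tendsto_prod_daisyConst)
      fun n => le_trans (le_add_of_nonneg_right (by positivity)) (h n)
  linarith

/-! ### Dense daisy-free families from bases of `𝔽₂ʳ` -/

open Classical in
/-- The index sets of size `r` on which `v` is a basis of `𝔽₂ʳ`. -/
noncomputable def basisFamily {n r : ℕ} (v : Fin n → Fin r → ZMod 2) :
    Finset (Finset (Fin n)) :=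
  (layer n r).filter (fun A => LinearIndepOn (ZMod 2) v (A : Set (Fin n)))

theorem mem_basisFamily {n r : ℕ} {v : Fin n → Fin r → ZMod 2} {A : Finset (Fin n)} :
    A ∈ basisFamily v ↔ A.card = r ∧ LinearIndepOn (ZMod 2) v (A : Set (Fin n)) := by
  simp [basisFamily, mem_layer]

theorem basisFamily_subset_layer {n r : ℕ} (v : Fin n → Fin r → ZMod 2) :
    basisFamily v ⊆ layer n r :=
  fun _ hA => mem_layer.2 (mem_basisFamily.1 hA).1

theorem daisyFree_basisFamily {n r : ℕ} (v : Fin n → Fin r → ZMod 2) :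
    DaisyFree r (basisFamily v) := by
  classical
  intro S T hS hT hST hsub
  have hind : ∀ a ∈ T, ∀ b ∈ T, a ≠ b →
      LinearIndepOn (ZMod 2) v (insert a (insert b (S : Set (Fin n)))) := fun a ha b hb hab => by
    have h : S ∪ {a, b} ∈ basisFamily v := hsub <| Finset.mem_image_of_mem _ <|
      Finset.mem_powersetCard.2 ⟨Finset.insert_subset ha (Finset.singleton_subset_iff.2 hb),
        Finset.card_pair hab⟩
    have h' := (mem_basisFamily.1 h).2
    refine h'.mono fun z hz => ?_
    simp only [Set.mem_insert_iff, Finset.mem_coe, Finset.mem_union, Finset.mem_insert,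
      Finset.mem_singleton] at hz ⊢
    tauto
  have hTS : ∀ a ∈ T, a ∉ (S : Set (Fin n)) := fun a ha hS => Finset.disjoint_right.1 hST ha hS
  have hspan : ∀ a ∈ T, ∀ b ∈ T, a ≠ b →
      v a ∉ Submodule.span (ZMod 2) (v '' insert b (S : Set (Fin n))) := fun a ha b hb hab =>
    ((linearIndepOn_insert (by simpa [hab] using hTS a ha)).1 (hind a ha b hb hab)).2
  have hother : ∀ a ∈ T, ∃ b ∈ T, b ≠ a := fun a _ =>
    Finset.exists_mem_ne (by omega) a
  set W := Submodule.span (ZMod 2) (v '' (S : Set (Fin n)))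
  have hWS : LinearIndepOn (ZMod 2) v (S : Set (Fin n)) := by
    obtain ⟨a, ha⟩ : T.Nonempty := Finset.card_pos.1 (by omega)
    obtain ⟨b, hb, hba⟩ := hother a ha
    exact (hind b hb a ha hba).mono ((Set.subset_insert _ _).trans (Set.subset_insert _ _))
  have hWrank : Module.finrank (ZMod 2) W = S.card := by
    have := finrank_span_eq_card (R := ZMod 2) hWS
    rw [← Set.image_eq_range] at this
    simpa using this
  have hWcard : Nat.card W = 2 ^ S.card := by
    rw [Module.natCard_eq_pow_finrank (K := ZMod 2), hWrank, Nat.card_zmod]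
  -- The stem has `r - 2` independent vectors, so the quotient is a plane over `𝔽₂`.
  have hQcard : Nat.card ((Fin r → ZMod 2) ⧸ W) = 4 := by
    have h := Submodule.card_eq_card_quotient_mul_card W
    have hpow : 2 ^ r = 2 ^ S.card * 4 := by rw [← hS, pow_add]; norm_num
    rw [hWcard, Nat.card_fun, Nat.card_zmod, Nat.card_fin, hpow] at h
    exact (Nat.eq_of_mul_eq_mul_left (by positivity) h).symm
  have hfin : Fintype ((Fin r → ZMod 2) ⧸ W) := Fintype.ofFinite _
  have hinj : Set.InjOn (fun a => W.mkQ (v a)) T := fun a ha b hb hab => by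
    by_contra hne
    refine hspan a ha b hb hne ?_
    have h1 : v a - v b ∈ W := (Submodule.Quotient.eq W).1 hab
    have h2 : v a = (v a - v b) + v b := by abel
    rw [h2]
    refine add_mem (Submodule.span_mono (Set.image_mono (Set.subset_insert _ _)) h1)
      (Submodule.subset_span ⟨b, Set.mem_insert _ _, rfl⟩)
  have hsubset : T.image (fun a => W.mkQ (v a)) ⊆ Finset.univ.erase 0 := by
    intro q hq
    obtain ⟨a, ha, rfl⟩ := Finset.mem_image.1 hq
    refine Finset.mem_erase.2 ⟨fun h0 => ?_, Finset.mem_univ _⟩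
    obtain ⟨b, hb, hba⟩ := hother a ha
    refine hspan a ha b hb hba.symm ?_
    exact Submodule.span_mono (Set.image_mono (Set.subset_insert _ _))
      ((Submodule.Quotient.mk_eq_zero W).1 h0)
  have := Finset.card_le_card hsubset
  rw [Finset.card_image_of_injOn hinj, Finset.card_erase_of_mem (Finset.mem_univ _),
    Finset.card_univ, ← Nat.card_eq_fintype_card, hQcard, hT] at this
  omega

theorem prod_two_pow_sub_two_pow (r : ℕ) :
    ((∏ i : Fin r, (2 ^ r - 2 ^ (i : ℕ)) : ℕ) : ℝ) =
      (∏ k ∈ Finset.range r, (1 - (1 / 2 : ℝ) ^ (k + 1))) * ((2 : ℝ) ^ r) ^ r := by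
  rw [Fin.prod_univ_eq_prod_range (fun i => 2 ^ r - 2 ^ i) r, Nat.cast_prod,
    ← Finset.prod_range_reflect (fun k => 1 - (1 / 2 : ℝ) ^ (k + 1))]
  have h : ((2 : ℝ) ^ r) ^ r = ∏ _k ∈ Finset.range r, (2 : ℝ) ^ r := by simp
  rw [h, ← Finset.prod_mul_distrib]
  refine Finset.prod_congr rfl fun i hi => ?_
  rw [Finset.mem_range] at hi
  rw [Nat.cast_sub (Nat.pow_le_pow_right (by norm_num) hi.le)]
  -- Factorwise, `2 ^ r - 2 ^ i = 2 ^ r * (1 - 2 ^ (-(r - i)))`; the reflection has matched `i` with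
  -- `k = r - 1 - i`.
  obtain ⟨m, rfl⟩ : ∃ m, r = i + (m + 1) := ⟨r - i - 1, by omega⟩
  have : i + (m + 1) - 1 - i + 1 = m + 1 := by omega
  rw [this, pow_add, sub_mul, one_mul, one_div, inv_pow]
  push_cast
  field_simp
  ring

open Classical in
theorem card_filter_linearIndepOn {n r : ℕ} {A : Finset (Fin n)} (hA : A.card = r) :
    (((Finset.univ : Finset (Fin n → Fin r → ZMod 2)).filter
      (fun v => LinearIndepOn (ZMod 2) v (A : Set (Fin n)))).card : ℝ) =
      (∏ k ∈ Finset.range r, (1 - (1 / 2 : ℝ) ^ (k + 1))) *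
        Fintype.card (Fin n → Fin r → ZMod 2) := by
  have hrn : r ≤ n := by simpa [hA] using A.card_le_univ
  let E := Equiv.piEquivPiSubtypeProd (fun i => i ∈ A) (fun _ : Fin n => Fin r → ZMod 2)
  let e : Fin r ≃ {i // i ∈ A} := (Fintype.equivFinOfCardEq (by simpa using hA)).symm
  -- Only the vectors indexed by `A` are constrained; the others are free.
  have e1 : {v : Fin n → Fin r → ZMod 2 // LinearIndepOn (ZMod 2) v (A : Set (Fin n))} ≃
      {w : Fin r → Fin r → ZMod 2 // LinearIndependent (ZMod 2) w} ×
        ({i // i ∉ A} → Fin r → ZMod 2) :=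
    calc _ ≃ {p : ({i // i ∈ A} → Fin r → ZMod 2) × ({i // i ∉ A} → Fin r → ZMod 2) //
          LinearIndependent (ZMod 2) p.1} := E.subtypeEquiv fun v => Iff.rfl
      _ ≃ {w : {i // i ∈ A} → Fin r → ZMod 2 // LinearIndependent (ZMod 2) w} ×
          ({i // i ∉ A} → Fin r → ZMod 2) := Equiv.prodSubtypeFstEquivSubtypeProd
          (p := fun w : {i // i ∈ A} → Fin r → ZMod 2 => LinearIndependent (ZMod 2) w)
      _ ≃ _ := Equiv.prodCongrLeft fun _ =>
          (e.symm.arrowCongr (Equiv.refl _)).subtypeEquiv fun w =>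
            (linearIndependent_equiv e).symm
  have hcount := Nat.card_congr e1
  have hLI := card_linearIndependent (K := ZMod 2) (V := Fin r → ZMod 2) (k := r) (by simp)
  simp only [Module.finrank_fin_fun, ZMod.card] at hLI
  have hcompl : Nat.card {i // i ∉ A} = n - r := by
    rw [Nat.card_eq_fintype_card, Fintype.card_subtype_compl, Fintype.card_fin,
      Fintype.card_coe, hA]
  rw [Nat.card_prod, hLI, Nat.card_fun, hcompl, Nat.card_fun, Nat.card_zmod, Nat.card_fin,
    Nat.card_eq_fintype_card, Fintype.card_subtype] at hcount
  rw [hcount, Nat.cast_mul, prod_two_pow_sub_two_pow, mul_assoc]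
  congr 1
  simp only [Fintype.card_fun, ZMod.card, Fintype.card_fin]
  push_cast
  rw [← pow_add, Nat.add_sub_cancel' hrn]

open Classical in
-- First moment method: count pairs of an assignment `v` and an `r`-set on which it is a basis.
theorem exists_daisyConst_mul_le_card_basisFamily (n r : ℕ) :
    ∃ v : Fin n → Fin r → ZMod 2,
      daisyConst * (n.choose r : ℝ) ≤ ((basisFamily v).card : ℝ) := by
  have hsum : ∑ v : Fin n → Fin r → ZMod 2, daisyConst * (n.choose r : ℝ) ≤
      ∑ v : Fin n → Fin r → ZMod 2, ((basisFamily v).card : ℝ) := by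
    have hswap : ∑ v : Fin n → Fin r → ZMod 2, ((basisFamily v).card : ℝ) =
        ∑ A ∈ layer n r, (((Finset.univ : Finset (Fin n → Fin r → ZMod 2)).filter
          (fun v => LinearIndepOn (ZMod 2) v (A : Set (Fin n)))).card : ℝ) := by
      simp only [basisFamily]
      exact_mod_cast Finset.sum_card_bipartiteAbove_eq_sum_card_bipartiteBelow
        (s := Finset.univ) (t := layer n r)
        (fun (v : Fin n → Fin r → ZMod 2) (A : Finset (Fin n)) =>
          LinearIndepOn (ZMod 2) v (A : Set (Fin n)))
    rw [hswap, Finset.sum_congr rfl fun A hA => card_filter_linearIndepOn (mem_layer.1 hA),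
      Finset.sum_const, Finset.sum_const, card_layer, Finset.card_univ, nsmul_eq_mul,
      nsmul_eq_mul]
    calc _ = (n.choose r : ℝ) * (daisyConst * Fintype.card (Fin n → Fin r → ZMod 2)) := by ring
      _ ≤ _ := by
        gcongr
        exact daisyConst_le_prod r
  obtain ⟨v, -, hv⟩ := Finset.exists_le_of_sum_le Finset.univ_nonempty hsum
  exact ⟨v, hv⟩

/-! ### Comparison of densities and conclusion -/

/-- If all layers among the middle ones are kept but one, a dense replacement of the latter
makes up for it. -/
theorem eventually_card_replaceMiddle_ge {d : ℕ} {G : (n : ℕ) → Finset (Finset (Fin n))} {c : ℝ}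
    (hG : ∀ n, G n ⊆ layer n (n / 2)) (hc : ∀ n, c * width n ≤ ((G n).card : ℝ)) {ε : ℝ}
    (hε : 0 < ε) :
    ∀ᶠ n : ℕ in atTop, ((middleLayers n d).card : ℝ) + (c - ε) * width n ≤
      ((replaceMiddle n d (G n)).card : ℝ) := by
  have h1 := (tendsto_card_middleLayers_div_width (d + 1)).sub
    (tendsto_card_middleLayers_div_width d)
  have h2 : ((d + 1 : ℕ) : ℝ) - d = 1 := by push_cast; ring
  rw [h2] at h1
  -- The extra layer eventually contributes more than `(1 - ε) * width n`; removing a layer costs at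
  -- most `width n`, and `G n` returns at least `c * width n`.
  filter_upwards [h1.eventually (lt_mem_nhds (sub_lt_self 1 hε))] with n hn
  have hw := width_pos n
  rw [← sub_div, lt_div_iff₀ hw] at hn
  have hcard : ((middleLayers n (d + 1)).card : ℝ) - width n + (G n).card ≤
      ((replaceMiddle n d (G n)).card : ℝ) := by
    have hdisj : Disjoint (middleLayers n (d + 1) \ layer n (n / 2)) (G n) :=
      Finset.disjoint_left.2 fun A hA hA' => (Finset.mem_sdiff.1 hA).2 (hG n hA')
    have h := Finset.le_card_sdiff (layer n (n / 2)) (middleLayers n (d + 1))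
    have h' : (middleLayers n (d + 1)).card ≤
        (middleLayers n (d + 1) \ layer n (n / 2)).card + n.choose (n / 2) := by
      rw [card_layer] at h
      omega
    have h'' : ((middleLayers n (d + 1)).card : ℝ) ≤
        (middleLayers n (d + 1) \ layer n (n / 2)).card + width n := by
      rw [width]
      exact_mod_cast h'
    rw [replaceMiddle, Finset.card_union_of_disjoint hdisj, Nat.cast_add]
    linarith
  have := hc n
  linarith

theorem card_le_maxSize {n : ℕ} {Free : Finset (Finset (Fin n)) → Prop}
    {F : Finset (Finset (Fin n))} (hF : Free F) : F.card ≤ maxSize n Free := by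
  classical
  exact Finset.le_sup (f := Finset.card) (by simpa using hF)

/-- If unions of layers with the property `Free` have at most `m n` elements, and other families
with that property are larger by a positive density, the greatest density is not attained by
unions of layers. -/
theorem not_attainedByLayers {Free : ∀ n : ℕ, Finset (Finset (Fin n)) → Prop} {m : ℕ → ℕ}
    (hm : ∀ n I, Free n (layersUnion n I) → (layersUnion n I).card ≤ m n)
    {F : (n : ℕ) → Finset (Finset (Fin n))} (hF : ∀ n, Free n (F n)) {δ : ℝ} (hδ : 0 < δ)
    (hlarge : ∀ᶠ n in atTop, (m n : ℝ) + δ * width n ≤ ((F n).card : ℝ)) :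
    ¬ AttainedByLayers Free := by
  rintro ⟨I, hI, hlim⟩
  obtain ⟨n, h1, h2, h3⟩ :=
    (hI.and (hlarge.and (hlim.eventually (gt_mem_nhds hδ)))).exists
  rw [div_lt_iff₀ (width_pos n)] at h3
  have h4 : ((layersUnion n (I n)).card : ℝ) ≤ m n := Nat.cast_le.2 (hm n _ h1)
  have h5 : ((F n).card : ℝ) ≤ maxSize n (Free n) := Nat.cast_le.2 (card_le_maxSize (hF n))
  linarith

theorem mainTheorem7 (d : ℕ) (hd : 4 ≤ d) :
    -- among the unions of layers with no copy of `B_d`, the middle `d` layers are largest,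
    -- and their density is asymptotically `d`
    (∀ n : ℕ, ¬ ContainsCopy (Finset (Fin d)) (middleLayers n d) ∧
      ∀ I : Finset ℕ, ¬ ContainsInducedCopy (Finset (Fin d)) (layersUnion n I) →
        (layersUnion n I).card ≤ (middleLayers n d).card) ∧
    Tendsto (fun n : ℕ => ((middleLayers n d).card : ℝ) / width n) atTop (𝓝 (d : ℝ)) ∧
    -- replacing the middle one of the middle `d + 1` layers by any daisy-free family
    -- leaves no copy of `B_d`
    (∀ (n : ℕ) (G : Finset (Finset (Fin n))), G ⊆ layer n (n / 2) → DaisyFree (n / 2) G →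
      ¬ ContainsCopy (Finset (Fin d)) (replaceMiddle n d G)) ∧
    -- with suitable dense daisy-free families, the result is asymptotically strictly larger
    0 < daisyConst ∧
    (∃ G : (n : ℕ) → Finset (Finset (Fin n)),
      (∀ n : ℕ, G n ⊆ layer n (n / 2) ∧ DaisyFree (n / 2) (G n) ∧
        daisyConst * width n ≤ ((G n).card : ℝ)) ∧
      ∀ ε : ℝ, 0 < ε → ∀ᶠ n : ℕ in atTop,
        ((middleLayers n d).card : ℝ) + (daisyConst - ε) * width n ≤
          ((replaceMiddle n d (G n)).card : ℝ)) ∧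
    -- hence the greatest density is not attained by unions of layers
    ¬ AttainedByLayers (fun _ F => ¬ ContainsCopy (Finset (Fin d)) F) ∧
    ¬ AttainedByLayers (fun _ F => ¬ ContainsInducedCopy (Finset (Fin d)) F) := by

  have hlayers : ∀ (n : ℕ) (I : Finset ℕ),
      ¬ ContainsInducedCopy (Finset (Fin d)) (layersUnion n I) →
        (layersUnion n I).card ≤ (middleLayers n d).card := fun n I hI =>
    card_layersUnion_le_card_middleLayers (by omega)
      (not_lt.1 fun h => hI (containsInducedCopy_layersUnion h))
  choose v hv using fun n : ℕ => exists_daisyConst_mul_le_card_basisFamily n (n / 2)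
  have hlarge : ∀ ε : ℝ, 0 < ε → ∀ᶠ n : ℕ in atTop,
      ((middleLayers n d).card : ℝ) + (daisyConst - ε) * width n ≤
        ((replaceMiddle n d (basisFamily (v n))).card : ℝ) := fun ε hε =>
    eventually_card_replaceMiddle_ge (fun n => basisFamily_subset_layer (v n)) hv hε
  have hfree : ∀ n, ¬ ContainsCopy (Finset (Fin d)) (replaceMiddle n d (basisFamily (v n))) :=
    fun n => not_containsCopy_replaceMiddle hd (basisFamily_subset_layer _)
      (daisyFree_basisFamily _)
  have hδ : 0 < daisyConst - daisyConst / 2 := by linarith [daisyConst_pos]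
  have hhalf := hlarge _ (half_pos daisyConst_pos)
  exact ⟨fun n => ⟨not_containsCopy_middleLayers n d, hlayers n⟩,
    tendsto_card_middleLayers_div_width d,
    fun n G hG hGfree => not_containsCopy_replaceMiddle hd hG hGfree,
    daisyConst_pos,
    ⟨fun n => basisFamily (v n),
      fun n => ⟨basisFamily_subset_layer _, daisyFree_basisFamily _, hv n⟩, hlarge⟩,
    not_attainedByLayers (fun n I h => hlayers n I fun h' => h h'.containsCopy) hfree hδ hhalf,
    not_attainedByLayers hlayers (fun n h => hfree n h.containsCopy) hδ hhalf⟩
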